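/- **Tableaux.** For a strict partition $\lambda=(\lambda_1>\dots>\lambda_k>0)$, the shifted shape $\lambda$ has $\lambda_i$ boxes in row $i$ (rows numbered downwards), indented by $i-1$ units, so that row $i$ starts on the main diagonal. An increasing shifted tableau is a filling of a shifted shape with positive integers, strictly increasing from left to right along rows and from top to bottom down columns. **Shifted Hecke insertion.** To insert a positive integer $x$ into an increasing shifted tableau $T$, start by inserting $x$ into the first row. The rules for inserting $x$ into a row (resp. column), possibly empty, are as follows. 1. If $x$ is weakly larger than all entries of the row (resp. column) and adjoining $x$ to its end gives an increasing shifted tableau, do so; the insertion terminates at the new box. 2. If $x$ is weakly larger than all entries of the row (resp. column) but adjoining $x$ to its end does not give an increasing shifted tableau, the tableau is not changed and the insertion terminates: for a nonempty row, at the bottom box of the column containing the rightmost box of this row; for an empty row, at the rightmost box of the previous row; for a column, at the rightmost box of the row containing the bottom box of this column. 3. Otherwise let $y$ be the smallest entry of the row (resp. column) that is strictly larger than $x$. Replace $y$ by $x$ if this gives an increasing shifted tableau; otherwise change nothing. In both cases continue by inserting $y$: if $x$ was inserted into a row and $y$ was not on the main diagonal, into the row below; if $x$ was inserted into a column, or if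 $y$ was on the main diagonal, into the next column to the right of the one containing $y$ (and from then on only into columns). **Recording tableau.** For a word $w=w_1w_2\cdots w_n$ of positive integers, insert $w_1,\dots,w_n$ successively, starting with the empty tableau. The recording tableau $Q(w)$ is the filling of the resulting shape with sets of primed and unprimed integers obtained by putting, for each $k=1,\dots,n$, a label into the box where the insertion of $w_k$ terminates: the label $k'$ if that insertion ended with a column insertion or with a failed insertion into an empty row, and the label $k$ otherwise. **Descent sets.** The descent set of $w$ is $\mathcal D(w)=\{i : 1\le i<n,\ w_i>w_{i+1}\}$. The descent set $\mathcal D(Q)$ of a recording tableau $Q$ is the set of all $i$ such that at least one of the following holds: - both $i$ and $(i+1)'$ appear in $Q$; - $i$ and $i+1$ appear in $Q$, and $i$ is in a row strictly above that of $i+1$; - $i'$ and $(i+1)'$ appear in $Q$, and $i'$ is in a row weakly below that of $(i+1)'$ but not in the same box. **Theorem.** For every word $w$ of positive integers, $\mathcal D(w)=\mathcal D(Q(w))$. -/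

import Mathlib

namespace ShiftedHecke

/-- A finite set of boxes `(r, c)` (row `r`, column `c`, both numbered from `0`, rows downwards),
each box filled with a number. Values of `entry` outside `cells` are irrelevant. -/
structure Filling where
  cells : Finset (ℕ × ℕ)
  entry : ℕ × ℕ → ℕ

/-- `S` is the shifted shape of a strict partition `λ₀ > λ₁ > ⋯`: row `r` occupies the columns
`r, …, r + λ_r - 1`. It is expressed by closure to the left (up to the main diagonal) and upwards;
see `isShiftedShape_iff` for the version with the partition. -/
def IsShiftedShape (S : Finset (ℕ × ℕ)) : Prop :=
  ∀ b ∈ S, b.1 ≤ b.2 ∧ (b.1 < b.2 → (b.1, b.2 - 1) ∈ S) ∧ (0 < b.1 → (b.1 - 1, b.2) ∈ S)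

instance (S : Finset (ℕ × ℕ)) : Decidable (IsShiftedShape S) := by
  unfold IsShiftedShape; infer_instance

/-- Shifted shapes are the diagrams of strict partitions (padded with zeros). -/
theorem isShiftedShape_iff (S : Finset (ℕ × ℕ)) :
    IsShiftedShape S ↔ ∃ lam : ℕ → ℕ, (∀ i, 0 < lam (i + 1) → lam (i + 1) < lam i) ∧
      ∀ r c, (r, c) ∈ S ↔ r ≤ c ∧ c < r + lam r := by
  constructor
  · intro h
    have hleft : ∀ r c d, (r, c + d) ∈ S → r ≤ c → (r, c) ∈ S := by
      intro r c d
      induction d with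
      | zero => intro h1 _; simpa using h1
      | succ d ih =>
        intro h1 h2
        exact ih ((h _ h1).2.1 (by simp; omega)) h2
    have hex : ∀ r, ∃ l, (r, r + l) ∉ S := by
      intro r
      by_contra hcon
      push Not at hcon
      have hinj : Function.Injective (fun l : ℕ => (r, r + l)) := by
        intro a b hab
        simpa using hab
      exact Set.infinite_of_injective_forall_mem (s := (S : Set (ℕ × ℕ))) hinj
        (fun l => by simpa using hcon l) S.finite_toSet
    classical
    have hrow : ∀ r c, (r, c) ∈ S ↔ r ≤ c ∧ c < r + Nat.find (hex r) := by
      intro r c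
      constructor
      · intro hc
        have hrc := (h _ hc).1
        refine ⟨hrc, ?_⟩
        by_contra hlt
        push Not at hlt
        apply Nat.find_spec (hex r)
        apply hleft r _ (c - (r + Nat.find (hex r))) _ (by omega)
        rwa [Nat.add_sub_cancel' hlt]
      · rintro ⟨h1, h2⟩
        have := Nat.find_min (hex r) (m := c - r) (by omega)
        rw [Nat.add_sub_cancel' h1] at this
        exact not_not.mp this
    refine ⟨fun r => Nat.find (hex r), ?_, hrow⟩
    intro i hi
    change 0 < Nat.find (hex (i + 1)) at hi
    change Nat.find (hex (i + 1)) < Nat.find (hex i)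
    have h1 : (i + 1, i + Nat.find (hex (i + 1))) ∈ S := (hrow _ _).2 ⟨by omega, by omega⟩
    have h2 := (h _ h1).2.2 (by simp)
    have := (hrow _ _).1 h2
    simp only [Nat.add_sub_cancel] at this
    omega
  · rintro ⟨lam, hlam, hS⟩ ⟨r, c⟩ hb
    have hb' := (hS r c).1 hb
    refine ⟨hb'.1, fun h => (hS _ _).2 ⟨by simp at h ⊢; omega, by simp at h ⊢; omega⟩, fun h => ?_⟩
    obtain ⟨k, rfl⟩ : ∃ k, r = k + 1 := ⟨r - 1, by simp at h; omega⟩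
    have := hlam k (by omega)
    exact (hS _ _).2 ⟨by simp; omega, by simp; omega⟩

namespace Filling

/-- An increasing shifted tableau: a filling of a shifted shape, strictly increasing along rows
from left to right and along columns from top to bottom. -/
def IsIncreasing (T : Filling) : Prop :=
  IsShiftedShape T.cells ∧
  (∀ a ∈ T.cells, ∀ b ∈ T.cells, a.1 = b.1 → a.2 < b.2 → T.entry a < T.entry b) ∧
  (∀ a ∈ T.cells, ∀ b ∈ T.cells, a.2 = b.2 → a.1 < b.1 → T.entry a < T.entry b)

instance (T : Filling) : Decidable T.IsIncreasing := by
  unfold IsIncreasing; infer_instance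

/-- The empty tableau. -/
def empty : Filling := ⟨∅, fun _ => 0⟩

/-- Put the label `x` into the box `b` (adjoining the box if it is not there yet,
replacing its label if it is). -/
def put (T : Filling) (b : ℕ × ℕ) (x : ℕ) : Filling :=
  ⟨insert b T.cells, Function.update T.entry b x⟩

/-- Number of boxes in row `r`. -/
def rowLen (T : Filling) (r : ℕ) : ℕ := (T.cells.filter (fun b => b.1 = r)).card

/-- Number of boxes in column `c`. -/
def colLen (T : Filling) (c : ℕ) : ℕ := (T.cells.filter (fun b => b.2 = c)).card

/-- The box just after the last box of row `r` (rows start on the diagonal). -/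
def rowEnd (T : Filling) (r : ℕ) : ℕ × ℕ := (r, r + T.rowLen r)

/-- The box just below the last box of column `c` (columns start in the top row). -/
def colEnd (T : Filling) (c : ℕ) : ℕ × ℕ := (T.colLen c, c)

/-- The rightmost box of a nonempty row `r`. -/
def rowLast (T : Filling) (r : ℕ) : ℕ × ℕ := (r, r + T.rowLen r - 1)

/-- The bottom box of a nonempty column `c`. -/
def colLast (T : Filling) (c : ℕ) : ℕ × ℕ := (T.colLen c - 1, c)

/-- Columns of the boxes of row `r` whose label is strictly larger than `x`. -/
def rowLarger (T : Filling) (r x : ℕ) : Finset ℕ :=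
  (T.cells.filter (fun b => b.1 = r ∧ x < T.entry b)).image Prod.snd

/-- Rows of the boxes of column `c` whose label is strictly larger than `x`. -/
def colLarger (T : Filling) (c x : ℕ) : Finset ℕ :=
  (T.cells.filter (fun b => b.2 = c ∧ x < T.entry b)).image Prod.fst

/-- Replace the label of the box `b` by `x` if this gives an increasing tableau;
otherwise change nothing. -/
def tryPut (T : Filling) (b : ℕ × ℕ) (x : ℕ) : Filling :=
  if (T.put b x).IsIncreasing then T.put b x else T

theorem tryPut_cells (T : Filling) (b : ℕ × ℕ) (x : ℕ) (hb : b ∈ T.cells) :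
    (T.tryPut b x).cells = T.cells := by
  unfold tryPut put
  split
  · simpa using hb
  · rfl

theorem mem_of_mem_rowLarger {T : Filling} {r x c : ℕ} (h : c ∈ T.rowLarger r x) :
    (r, c) ∈ T.cells := by
  simp only [rowLarger, Finset.mem_image, Finset.mem_filter] at h
  obtain ⟨⟨r', c'⟩, ⟨h1, h2, -⟩, h3⟩ := h
  simp only at h2 h3
  subst h2 h3
  exact h1

theorem mem_of_mem_colLarger {T : Filling} {c x r : ℕ} (h : r ∈ T.colLarger c x) :
    (r, c) ∈ T.cells := by
  simp only [colLarger, Finset.mem_image, Finset.mem_filter] at h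
  obtain ⟨⟨r', c'⟩, ⟨h1, h2, -⟩, h3⟩ := h
  simp only at h2 h3
  subst h2 h3
  exact h1

end Filling

/-- Result of an insertion: the new tableau, the box where the insertion terminates, and whether
this is to be recorded by a primed label. -/
structure InsertResult where
  tableau : Filling
  box : ℕ × ℕ
  primed : Bool

/-- Column insertion of `x`, starting with column `c`. The smallest label larger than `x` in a
(strictly increasing) column is the topmost one. -/
def colInsert (T : Filling) (c x : ℕ) : InsertResult :=
  if h : (T.colLarger c x).Nonempty then
    colInsert (T.tryPut ((T.colLarger c x).min' h, c) x) (c + 1)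
      (T.entry ((T.colLarger c x).min' h, c))
  else if (T.put (T.colEnd c) x).IsIncreasing then
    ⟨T.put (T.colEnd c) x, T.colEnd c, true⟩
  else
    ⟨T, T.rowLast (T.colLast c).1, true⟩
termination_by (T.cells.filter (fun b => c ≤ b.2)).card
decreasing_by
  have hm := Filling.mem_of_mem_colLarger (Finset.min'_mem _ h)
  rw [Filling.tryPut_cells _ _ _ hm]
  apply Finset.card_lt_card
  refine ⟨fun b hb => ?_, fun hsub => ?_⟩
  · simp only [Finset.mem_filter] at hb ⊢
    exact ⟨hb.1, by omega⟩
  · have := hsub (Finset.mem_filter.2 ⟨hm, le_refl _⟩)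
    simp at this

/-- Row insertion of `x`, starting with row `r`. The smallest label larger than `x` in a
(strictly increasing) row is the leftmost one; if it lies on the main diagonal, i.e. in column `r`,
the insertion goes on by column insertion into the column `r + 1`, otherwise by row insertion into
the row `r + 1`. -/
def rowInsert (T : Filling) (r x : ℕ) : InsertResult :=
  if h : (T.rowLarger r x).Nonempty then
    if (T.rowLarger r x).min' h = r then
      colInsert (T.tryPut (r, (T.rowLarger r x).min' h) x) (r + 1)
        (T.entry (r, (T.rowLarger r x).min' h))
    else
      rowInsert (T.tryPut (r, (T.rowLarger r x).min' h) x) (r + 1)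
        (T.entry (r, (T.rowLarger r x).min' h))
  else if (T.put (T.rowEnd r) x).IsIncreasing then
    ⟨T.put (T.rowEnd r) x, T.rowEnd r, false⟩
  else if T.rowLen r = 0 then
    ⟨T, T.rowLast (r - 1), true⟩
  else
    ⟨T, T.colLast (T.rowLast r).2, false⟩
termination_by (T.cells.filter (fun b => r ≤ b.1)).card
decreasing_by
  have hm := Filling.mem_of_mem_rowLarger (Finset.min'_mem _ h)
  rw [Filling.tryPut_cells _ _ _ hm]
  apply Finset.card_lt_card
  refine ⟨fun b hb => ?_, fun hsub => ?_⟩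
  · simp only [Finset.mem_filter] at hb ⊢
    exact ⟨hb.1, by omega⟩
  · have := hsub (Finset.mem_filter.2 ⟨hm, le_refl _⟩)
    simp at this

/-- Shifted Hecke insertion of a letter: row insertion into the first row. -/
def insertLetter (T : Filling) (x : ℕ) : InsertResult := rowInsert T 0 x

/-- A primed or unprimed integer. -/
structure Label where
  value : ℕ
  primed : Bool
deriving DecidableEq

/-- Set-valued fillings: the set of labels in each box (empty outside the shape). -/
abbrev SetFilling := ℕ × ℕ → Finset Label

/-- The insertion tableau of the letters read so far, the recording tableau, and the number of
letters read. -/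
structure State where
  P : Filling
  Q : SetFilling
  len : ℕ

/-- Read one more letter: insert it and put its (primed or unprimed) position into the box of the
recording tableau where its insertion terminates. -/
def State.step (s : State) (x : ℕ) : State :=
  let res := insertLetter s.P x
  { P := res.tableau
    Q := Function.update s.Q res.box (insert ⟨s.len + 1, res.primed⟩ (s.Q res.box))
    len := s.len + 1 }

/-- Insertion of all the letters of a word, from left to right. -/
def run (w : List ℕ) : State := w.foldl State.step ⟨Filling.empty, fun _ => ∅, 0⟩

/-- The insertion tableau of a word. -/
def insertionTableau (w : List ℕ) : Filling := (run w).P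

/-- The recording tableau of a word. -/
def recordingTableau (w : List ℕ) : SetFilling := (run w).Q

/-- The descent set of a word `w₁ w₂ ⋯ wₙ` (positions numbered from `1`). -/
def wordDescents (w : List ℕ) : Set ℕ :=
  {i | 1 ≤ i ∧ ∃ a b, w[i - 1]? = some a ∧ w[i]? = some b ∧ b < a}

/-- The descent set of a standard set-valued shifted tableau. -/
def tableauDescents (Q : SetFilling) : Set ℕ :=
  {i |
    (∃ s t, ⟨i, false⟩ ∈ Q s ∧ ⟨i + 1, true⟩ ∈ Q t) ∨
    (∃ s t, ⟨i, false⟩ ∈ Q s ∧ ⟨i + 1, false⟩ ∈ Q t ∧ s.1 < t.1) ∨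
    (∃ s t, ⟨i, true⟩ ∈ Q s ∧ ⟨i + 1, true⟩ ∈ Q t ∧ t.1 ≤ s.1 ∧ s ≠ t)}

end ShiftedHecke

/-!
Reflecting a shifted tableau in its main diagonal gives a symmetric *doubled* tableau. In it a
column insertion into column `k` is an insertion into row `k`, so a shifted Hecke insertion is a
plain row insertion: round `k` inserts into row `k`, whatever its kind. If the insertion terminates
at the box `(a, b)` of the doubled tableau, then its label is primed exactly if `(a, b)` lies
strictly below the diagonal. The theorem thus becomes a row bumping lemma: for consecutive letters
`x, x'` terminating at `(a, b)` and `(a', b')`, a descent `x' < x` forces `a < a'` and `b' ≤ b`,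
while `x ≤ x'` forces `a' ≤ a` and `b < b'` unless the two boxes coincide.
-/

namespace ShiftedHecke

/-- The box of the shifted shape that represents the box `(i, j)` of the doubled shape, that is,
whichever of `(i, j)` and `(j, i)` lies weakly above the diagonal. -/
def cell (i j : ℕ) : ℕ × ℕ := (min i j, max i j)

theorem cell_comm (i j : ℕ) : cell i j = cell j i := by
  rw [cell, cell, min_comm, max_comm]

theorem cell_of_le {i j : ℕ} (h : i ≤ j) : cell i j = (i, j) := by
  rw [cell, min_eq_left h, max_eq_right h]

theorem cell_of_ge {i j : ℕ} (h : j ≤ i) : cell i j = (j, i) := by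
  rw [cell_comm, cell_of_le h]

theorem cell_eq_cell_iff {i j k p : ℕ} :
    cell i j = cell k p ↔ i = k ∧ j = p ∨ i = p ∧ j = k := by
  simp only [cell, Prod.mk.injEq]
  omega

theorem cell_right_injective (i : ℕ) : Function.Injective (cell i) := by
  intro j j' h
  have := cell_eq_cell_iff.1 h
  omega

theorem cell_succ_left_ne (i j : ℕ) : cell (i + 1) j ≠ cell i j := by
  rw [Ne, cell_eq_cell_iff]
  omega

namespace Filling

variable {T : Filling} {i i' j j' k p x : ℕ}

/-- The box `(i, j)` belongs to the doubled shape of `T`. -/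
def Has (T : Filling) (i j : ℕ) : Prop := cell i j ∈ T.cells

/-- The label of the box `(i, j)` of the doubled tableau of `T`. -/
def val (T : Filling) (i j : ℕ) : ℕ := T.entry (cell i j)

theorem has_comm : T.Has i j ↔ T.Has j i := by
  rw [Has, cell_comm, Has]

theorem val_comm (T : Filling) (i j : ℕ) : T.val i j = T.val j i := by
  rw [val, cell_comm, val]

theorem exists_not_has (T : Filling) (i : ℕ) : ∃ j, ¬ T.Has i j := by
  obtain ⟨j, hj⟩ := Infinite.exists_notMem_finset
    (T.cells.preimage (cell i) (cell_right_injective i).injOn)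
  exact ⟨j, fun h => hj (Finset.mem_preimage.2 h)⟩

theorem IsIncreasing.has_and_val_lt_succ_right (hT : T.IsIncreasing) (h : T.Has i (j + 1)) :
    T.Has i j ∧ T.val i j < T.val i (j + 1) := by
  obtain ⟨hshape, hrow, hcol⟩ := hT
  rcases Nat.lt_or_ge j i with hji | hij
  · rw [Has, cell_of_ge hji] at h
    rw [Has, val, val, cell_of_ge hji, cell_of_ge hji.le]
    have h' := (hshape _ h).2.2 j.succ_pos
    exact ⟨h', hcol _ h' _ h rfl j.lt_succ_self⟩
  · have hij' := Nat.le_succ_of_le hij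
    rw [Has, cell_of_le hij'] at h
    rw [Has, val, val, cell_of_le hij', cell_of_le hij]
    have h' := (hshape _ h).2.1 (Nat.lt_succ_of_le hij)
    exact ⟨h', hrow _ h' _ h rfl j.lt_succ_self⟩

theorem IsIncreasing.has_and_val_lt_right (hT : T.IsIncreasing) (h : T.Has i j) (hj : j' < j) :
    T.Has i j' ∧ T.val i j' < T.val i j := by
  induction j, hj using Nat.le_induction with
  | base => exact hT.has_and_val_lt_succ_right h
  | succ j _ ih =>
    obtain ⟨h', hlt⟩ := hT.has_and_val_lt_succ_right h
    exact ⟨(ih h').1, (ih h').2.trans hlt⟩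

theorem isIncreasing_iff : T.IsIncreasing ↔ (∀ b ∈ T.cells, b.1 ≤ b.2) ∧
    ∀ i j j', T.Has i j → j' < j → T.Has i j' ∧ T.val i j' < T.val i j := by
  refine ⟨fun hT => ⟨fun b hb => (hT.1 b hb).1, fun i j j' => hT.has_and_val_lt_right⟩, ?_⟩
  rintro ⟨hdiag, hright⟩
  have row : ∀ {r c}, (r, c) ∈ T.cells → T.Has r c :=
    fun h => by rwa [Has, cell_of_le (hdiag _ h)]
  have col : ∀ {r c}, (r, c) ∈ T.cells → T.Has c r := fun h => has_comm.1 (row h)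
  refine ⟨fun ⟨r, c⟩ h => ⟨hdiag _ h, fun (hrc : r < c) => ?_, fun (hr : 0 < r) => ?_⟩, ?_, ?_⟩
  · have hle : r ≤ c - 1 := by omega
    simpa only [Has, cell_of_le hle] using (hright r c (c - 1) (row h) (by omega)).1
  · have hrc : r ≤ c := hdiag _ h
    have hle : r - 1 ≤ c := by omega
    simpa only [Has, cell_of_ge hle] using (hright c r (r - 1) (col h) (by omega)).1
  · rintro ⟨r, c⟩ h ⟨_, c'⟩ h' rfl hcc
    simpa only [val, cell_of_le (hdiag _ h), cell_of_le (hdiag _ h')] using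
      (hright r c' c (row h') hcc).2
  · rintro ⟨r, c⟩ h ⟨r', _⟩ h' rfl hrr
    simpa only [val, cell_of_ge (hdiag _ h), cell_of_ge (hdiag _ h')] using
      (hright c r' r (col h') hrr).2

theorem IsIncreasing.has_mono (hT : T.IsIncreasing) (h : T.Has i j) (hi : i' ≤ i) (hj : j' ≤ j) :
    T.Has i' j' := by
  have right : ∀ {i j j'}, T.Has i j → j' ≤ j → T.Has i j' := fun h hj =>
    hj.eq_or_lt.elim (fun e => e ▸ h) fun hlt => (hT.has_and_val_lt_right h hlt).1
  exact has_comm.1 (right (has_comm.1 (right h hj)) hi)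

theorem IsIncreasing.val_lt_right (hT : T.IsIncreasing) (h : T.Has i j) (hj : j' < j) :
    T.val i j' < T.val i j :=
  (hT.has_and_val_lt_right h hj).2

theorem IsIncreasing.val_le_right (hT : T.IsIncreasing) (h : T.Has i j) (hj : j' ≤ j) :
    T.val i j' ≤ T.val i j :=
  hj.eq_or_lt.elim (fun e => e ▸ le_rfl) fun hlt => (hT.val_lt_right h hlt).le

theorem IsIncreasing.val_lt_down (hT : T.IsIncreasing) (h : T.Has i j) (hi : i' < i) :
    T.val i' j < T.val i j := by
  rw [val_comm T i', val_comm T i]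
  exact hT.val_lt_right (has_comm.1 h) hi

theorem IsIncreasing.val_le_down (hT : T.IsIncreasing) (h : T.Has i j) (hi : i' ≤ i) :
    T.val i' j ≤ T.val i j :=
  hi.eq_or_lt.elim (fun e => e ▸ le_rfl) fun hlt => (hT.val_lt_down h hlt).le

theorem IsIncreasing.exists_has_iff_le (hT : T.IsIncreasing) (h : T.Has i j) :
    ∃ m, ∀ j, T.Has i j ↔ j ≤ m := by
  classical
  have hex := T.exists_not_has i
  have hpos : 0 < Nat.find hex :=
    (Nat.find_pos hex).2 (not_not.2 (hT.has_mono h le_rfl (Nat.zero_le j)))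
  refine ⟨Nat.find hex - 1, fun j => ⟨fun hj => ?_, fun hj => ?_⟩⟩
  · by_contra hlt
    exact Nat.find_spec hex (hT.has_mono hj le_rfl (by omega))
  · exact not_not.1 (Nat.find_min hex (by omega))

theorem IsIncreasing.mem_cells_iff (hT : T.IsIncreasing) {r c : ℕ} :
    (r, c) ∈ T.cells ↔ r ≤ c ∧ T.Has r c := by
  refine ⟨fun h => ?_, fun ⟨hrc, h⟩ => by rwa [Has, cell_of_le hrc] at h⟩
  have hrc : r ≤ c := (hT.1 _ h).1
  exact ⟨hrc, by rwa [Has, cell_of_le hrc]⟩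

theorem IsIncreasing.rowLen_eq {l : ℕ} (hT : T.IsIncreasing) (hl : ∀ j, T.Has k j ↔ j < l) :
    T.rowLen k = l - k := by
  have hrow : T.cells.filter (fun b => b.1 = k) = {k} ×ˢ Finset.Ico k l := by
    ext ⟨r, c⟩
    simp only [Finset.mem_filter, hT.mem_cells_iff, Finset.mem_product, Finset.mem_singleton,
      Finset.mem_Ico]
    constructor
    · rintro ⟨⟨hrc, h⟩, rfl⟩
      exact ⟨rfl, hrc, (hl c).1 h⟩
    · rintro ⟨rfl, hrc, h⟩
      exact ⟨⟨hrc, (hl c).2 h⟩, rfl⟩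
  rw [rowLen, hrow, Finset.card_product, Finset.card_singleton, Nat.card_Ico, one_mul]

theorem IsIncreasing.colLen_eq {l : ℕ} (hT : T.IsIncreasing) (hl : ∀ j, T.Has k j ↔ j < l) :
    T.colLen k = min l (k + 1) := by
  have hcol : T.cells.filter (fun b => b.2 = k) = Finset.range (min l (k + 1)) ×ˢ {k} := by
    ext ⟨r, c⟩
    simp only [Finset.mem_filter, hT.mem_cells_iff, Finset.mem_product, Finset.mem_singleton,
      Finset.mem_range, lt_min_iff, Nat.lt_succ_iff, has_comm (i := r)]
    constructor
    · rintro ⟨⟨hrc, h⟩, rfl⟩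
      exact ⟨⟨(hl r).1 h, hrc⟩, rfl⟩
    · rintro ⟨⟨h, hrc⟩, rfl⟩
      exact ⟨⟨hrc, (hl r).2 h⟩, rfl⟩
  rw [colLen, hcol, Finset.card_product, Finset.card_singleton, Finset.card_range, mul_one]

theorem IsIncreasing.mem_rowLarger_iff (hT : T.IsIncreasing) :
    j ∈ T.rowLarger k x ↔ k ≤ j ∧ T.Has k j ∧ x < T.val k j := by
  simp only [rowLarger, Finset.mem_image, Finset.mem_filter]
  constructor
  · rintro ⟨⟨r, c⟩, ⟨h, rfl, hx⟩, rfl⟩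
    obtain ⟨hrc, hhas⟩ := hT.mem_cells_iff.1 h
    exact ⟨hrc, hhas, by rwa [val, cell_of_le hrc]⟩
  · rintro ⟨hkj, h, hx⟩
    rw [val, cell_of_le hkj] at hx
    exact ⟨(k, j), ⟨hT.mem_cells_iff.2 ⟨hkj, h⟩, rfl, hx⟩, rfl⟩

theorem IsIncreasing.mem_colLarger_iff (hT : T.IsIncreasing) :
    j ∈ T.colLarger k x ↔ j ≤ k ∧ T.Has k j ∧ x < T.val k j := by
  simp only [colLarger, Finset.mem_image, Finset.mem_filter]
  constructor
  · rintro ⟨⟨r, c⟩, ⟨h, rfl, hx⟩, rfl⟩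
    obtain ⟨hrc, hhas⟩ := hT.mem_cells_iff.1 h
    exact ⟨hrc, has_comm.1 hhas, by rwa [val, cell_of_ge hrc]⟩
  · rintro ⟨hjk, h, hx⟩
    rw [val, cell_of_ge hjk] at hx
    exact ⟨(j, k), ⟨hT.mem_cells_iff.2 ⟨hjk, has_comm.1 h⟩, rfl, hx⟩, rfl⟩

theorem has_put {b : ℕ × ℕ} : (T.put b x).Has i j ↔ cell i j = b ∨ T.Has i j :=
  Finset.mem_insert

theorem entry_put_self (T : Filling) (b : ℕ × ℕ) (x : ℕ) : (T.put b x).entry b = x :=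
  Function.update_self _ _ _

theorem entry_put_of_ne (T : Filling) {b c : ℕ × ℕ} (x : ℕ) (h : c ≠ b) :
    (T.put b x).entry c = T.entry c :=
  Function.update_of_ne h _ _

theorem IsIncreasing.put (hT : T.IsIncreasing)
    (hleft : ∀ j < p, T.Has k j ∧ T.val k j < x) (habove : ∀ i < k, T.Has i p ∧ T.val i p < x)
    (hlt : T.Has k p → x < T.val k p) : (T.put (cell k p) x).IsIncreasing := by
  refine isIncreasing_iff.2 ⟨fun b hb => ?_, fun i j j' h hj => ?_⟩
  · rcases Finset.mem_insert.1 hb with rfl | hb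
    · exact min_le_max
    · exact (hT.1 b hb).1
  rw [has_put] at h ⊢
  simp only [val]
  by_cases hnew : cell i j = cell k p
  · have hne : cell i j' ≠ cell k p := fun e => hj.ne (cell_right_injective i (e.trans hnew.symm))
    rw [hnew, entry_put_self, entry_put_of_ne _ _ hne]
    rcases cell_eq_cell_iff.1 hnew with ⟨rfl, rfl⟩ | ⟨rfl, rfl⟩
    · exact (hleft j' hj).imp_left Or.inr
    · rw [cell_comm, has_comm]
      exact (habove j' hj).imp_left Or.inr
  · obtain ⟨h', hlt'⟩ := hT.has_and_val_lt_right (h.resolve_left hnew) hj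
    refine ⟨Or.inr h', ?_⟩
    rw [entry_put_of_ne _ _ hnew]
    by_cases hold : cell i j' = cell k p
    · rw [Has, hold] at h'
      rw [val, hold] at hlt'
      rw [hold, entry_put_self]
      exact (hlt h').trans hlt'
    · rwa [entry_put_of_ne _ _ hold]

theorem IsIncreasing.tryPut (hT : T.IsIncreasing) (b : ℕ × ℕ) (x : ℕ) :
    (T.tryPut b x).IsIncreasing := by
  unfold Filling.tryPut
  split
  · assumption
  · exact hT

theorem isIncreasing_empty : empty.IsIncreasing := by decide

/-- The first position of row `k` of the doubled tableau that is free or holds a label larger than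
`x`: the place where `x` is to be inserted into this row. -/
noncomputable def insertPos (T : Filling) (k x : ℕ) : ℕ := sInf {j | T.Has k j → x < T.val k j}

theorem has_and_val_le_of_lt_insertPos (hj : j < T.insertPos k x) :
    T.Has k j ∧ T.val k j ≤ x := by
  simpa only [Set.mem_ofPred_eq, Classical.not_imp, not_lt] using Nat.notMem_of_lt_sInf hj

theorem lt_val_insertPos (h : T.Has k (T.insertPos k x)) : x < T.val k (T.insertPos k x) := by
  obtain ⟨j, hj⟩ := T.exists_not_has k
  exact Nat.sInf_mem (s := {j | T.Has k j → x < T.val k j}) ⟨j, fun h => absurd h hj⟩ h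

theorem insertPos_le (h : T.Has k j → x < T.val k j) : T.insertPos k x ≤ j :=
  Nat.sInf_le h

theorem IsIncreasing.has_iff_lt_insertPos (hT : T.IsIncreasing)
    (hfree : ¬ T.Has k (T.insertPos k x)) : T.Has k j ↔ j < T.insertPos k x := by
  refine ⟨fun h => ?_, fun h => (has_and_val_le_of_lt_insertPos h).1⟩
  by_contra hle
  exact hfree (hT.has_mono h le_rfl (not_lt.1 hle))

theorem IsIncreasing.obstruction_of_not_put (hT : T.IsIncreasing)
    (h : ¬ (T.put (cell k (T.insertPos k x)) x).IsIncreasing) :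
    (∃ q, T.insertPos k x = q + 1 ∧ T.val k q = x) ∨
      ∃ m, k = m + 1 ∧ (T.Has m (T.insertPos k x) → x ≤ T.val m (T.insertPos k x)) := by
  contrapose! h
  obtain ⟨hleft, habove⟩ := h
  refine hT.put (fun j hj => ?_) (fun i hi => ?_) lt_val_insertPos
  · obtain ⟨q, hq⟩ : ∃ q, T.insertPos k x = q + 1 := ⟨T.insertPos k x - 1, by omega⟩
    obtain ⟨hhas, hle⟩ := has_and_val_le_of_lt_insertPos (show q < T.insertPos k x by omega)
    exact ⟨(has_and_val_le_of_lt_insertPos hj).1,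
      (hT.val_le_right hhas (by omega)).trans_lt (hle.lt_of_ne (hleft q hq))⟩
  · obtain ⟨m, rfl⟩ : ∃ m, k = m + 1 := ⟨k - 1, by omega⟩
    obtain ⟨hhas, hlt⟩ := habove m rfl
    have him : i ≤ m := by omega
    exact ⟨hT.has_mono hhas him le_rfl, (hT.val_le_down hhas him).trans_lt hlt⟩

/-- The box `(a, b)` of the doubled shape of `T` is the bottom box of the column that contains the
last box of row `k`. For the tableau obtained from an insertion that stopped in row `k`, this is
the box where the insertion terminates, whichever rule applied. -/
structure IsEndBox (T : Filling) (k a b : ℕ) : Prop where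
  has_row_iff : ∀ j, T.Has k j ↔ j ≤ b
  has_col_iff : ∀ i, T.Has i b ↔ i ≤ a

section IsEndBox

variable {a b : ℕ}

theorem IsIncreasing.exists_isEndBox (hT : T.IsIncreasing) (h : T.Has k j) :
    ∃ a b, T.IsEndBox k a b := by
  obtain ⟨b, hb⟩ := hT.exists_has_iff_le h
  obtain ⟨a, ha⟩ := hT.exists_has_iff_le (has_comm.1 ((hb b).2 le_rfl))
  exact ⟨a, b, hb, fun i => has_comm.trans (ha i)⟩

theorem IsEndBox.has (h : T.IsEndBox k a b) : T.Has a b := (h.has_col_iff a).2 le_rfl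

theorem IsEndBox.le (h : T.IsEndBox k a b) : k ≤ a :=
  (h.has_col_iff k).1 ((h.has_row_iff b).2 le_rfl)

theorem IsEndBox.eq_of_put (h : (T.put (cell k (T.insertPos k x)) x).IsEndBox k a b)
    (hT : T.IsIncreasing) (hfree : ¬ T.Has k (T.insertPos k x)) :
    a = k ∧ b = T.insertPos k x := by
  have hpb : T.insertPos k x ≤ b := (h.has_row_iff _).1 (has_put.2 (Or.inl rfl))
  have hb : b = T.insertPos k x := by
    rcases has_put.1 ((h.has_row_iff b).2 le_rfl) with hnew | hold
    · exact cell_right_injective k hnew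
    · have := (hT.has_iff_lt_insertPos hfree).1 hold
      omega
  refine ⟨le_antisymm (not_lt.1 fun hka => ?_) h.le, hb⟩
  rcases has_put.1 ((h.has_col_iff (k + 1)).2 hka) with hnew | hold
  · exact cell_succ_left_ne k b (hnew.trans (by rw [hb]))
  · exact hfree (hT.has_mono hold k.le_succ hb.ge)

theorem IsEndBox.insertPos_eq (h : T.IsEndBox k a b) (hT : T.IsIncreasing)
    (hfree : ¬ T.Has k (T.insertPos k x)) : T.insertPos k x = b + 1 := by
  have hrow : ∀ j, j < T.insertPos k x ↔ j ≤ b := fun j =>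
    (hT.has_iff_lt_insertPos hfree).symm.trans (h.has_row_iff j)
  have h1 := hrow b
  have h2 := hrow (b + 1)
  omega

end IsEndBox

section OneRound

variable {a b : ℕ}

theorem IsIncreasing.min'_colLarger (hT : T.IsIncreasing) (hle : T.insertPos k x ≤ k)
    (h : T.Has k (T.insertPos k x)) :
    ∃ hne : (T.colLarger k x).Nonempty, (T.colLarger k x).min' hne = T.insertPos k x := by
  have hmem : T.insertPos k x ∈ T.colLarger k x :=
    hT.mem_colLarger_iff.2 ⟨hle, h, lt_val_insertPos h⟩
  refine ⟨⟨_, hmem⟩, (Finset.min'_le _ _ hmem).antisymm (insertPos_le fun _ => ?_)⟩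
  exact (hT.mem_colLarger_iff.1 (Finset.min'_mem _ _)).2.2

theorem IsIncreasing.min'_rowLarger (hT : T.IsIncreasing) (hle : k ≤ T.insertPos k x)
    (h : T.Has k (T.insertPos k x)) :
    ∃ hne : (T.rowLarger k x).Nonempty, (T.rowLarger k x).min' hne = T.insertPos k x := by
  have hmem : T.insertPos k x ∈ T.rowLarger k x :=
    hT.mem_rowLarger_iff.2 ⟨hle, h, lt_val_insertPos h⟩
  refine ⟨⟨_, hmem⟩, (Finset.min'_le _ _ hmem).antisymm (insertPos_le fun _ => ?_)⟩
  exact (hT.mem_rowLarger_iff.1 (Finset.min'_mem _ _)).2.2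

theorem IsIncreasing.not_lt_val_of_free (hT : T.IsIncreasing)
    (hfree : ¬ T.Has k (T.insertPos k x)) (h : T.Has k j) : ¬ x < T.val k j :=
  not_lt.2 (has_and_val_le_of_lt_insertPos ((hT.has_iff_lt_insertPos hfree).1 h)).2

theorem colInsert_of_has (hT : T.IsIncreasing) (hle : T.insertPos k x ≤ k)
    (h : T.Has k (T.insertPos k x)) :
    colInsert T k x = colInsert (T.tryPut (cell k (T.insertPos k x)) x) (k + 1)
      (T.val k (T.insertPos k x)) := by
  obtain ⟨hne, hmin⟩ := hT.min'_colLarger hle h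
  rw [colInsert, dif_pos hne, hmin, val, cell_of_ge hle]

theorem rowInsert_of_has (hT : T.IsIncreasing) (hle : k ≤ T.insertPos k x)
    (h : T.Has k (T.insertPos k x)) :
    rowInsert T k x = (if T.insertPos k x = k then colInsert else rowInsert)
      (T.tryPut (cell k (T.insertPos k x)) x) (k + 1) (T.val k (T.insertPos k x)) := by
  obtain ⟨hne, hmin⟩ := hT.min'_rowLarger hle h
  rw [rowInsert, dif_pos hne, hmin, val, cell_of_le hle]
  split <;> rfl

theorem colInsert_of_free (hT : T.IsIncreasing) (hlt : T.insertPos k x < k)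
    (hfree : ¬ T.Has k (T.insertPos k x))
    (hend : (T.tryPut (cell k (T.insertPos k x)) x).IsEndBox k a b) :
    colInsert T k x = ⟨T.tryPut (cell k (T.insertPos k x)) x, cell a b, decide (b < a)⟩ := by
  have hne : ¬ (T.colLarger k x).Nonempty := fun ⟨j, hj⟩ =>
    hT.not_lt_val_of_free hfree (hT.mem_colLarger_iff.1 hj).2.1 (hT.mem_colLarger_iff.1 hj).2.2
  have hlen := hT.colLen_eq fun j => hT.has_iff_lt_insertPos (j := j) hfree
  have hcolEnd : T.colEnd k = cell k (T.insertPos k x) := by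
    rw [colEnd, hlen, cell_of_ge hlt.le, min_eq_left (by omega)]
  rw [colInsert, dif_neg hne, hcolEnd]
  unfold tryPut at hend ⊢
  split_ifs at hend ⊢ with hput
  · obtain ⟨rfl, rfl⟩ := hend.eq_of_put hT hfree
    rw [decide_eq_true hlt]
  · have hpos := hend.insertPos_eq hT hfree
    have hba : b < a := lt_of_lt_of_le (by omega) hend.le
    have hrowLen : T.rowLen b = a + 1 - b := hT.rowLen_eq fun i =>
      has_comm.trans ((hend.has_col_iff i).trans Nat.lt_succ_iff.symm)
    have hbox : T.rowLast (T.colLast k).1 = cell a b := by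
      rw [colLast, hlen, hpos, min_eq_left (by omega), Nat.add_sub_cancel, rowLast, hrowLen,
        cell_of_ge hba.le, show b + (a + 1 - b) - 1 = a by omega]
    rw [hbox, decide_eq_true hba]

theorem rowInsert_of_free (hT : T.IsIncreasing) (hle : k ≤ T.insertPos k x)
    (hfree : ¬ T.Has k (T.insertPos k x))
    (hend : (T.tryPut (cell k (T.insertPos k x)) x).IsEndBox k a b) :
    rowInsert T k x = ⟨T.tryPut (cell k (T.insertPos k x)) x, cell a b, decide (b < a)⟩ := by
  have hne : ¬ (T.rowLarger k x).Nonempty := fun ⟨j, hj⟩ =>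
    hT.not_lt_val_of_free hfree (hT.mem_rowLarger_iff.1 hj).2.1 (hT.mem_rowLarger_iff.1 hj).2.2
  have hlen := hT.rowLen_eq fun j => hT.has_iff_lt_insertPos (j := j) hfree
  have hrowEnd : T.rowEnd k = cell k (T.insertPos k x) := by
    rw [rowEnd, hlen, cell_of_le hle, Nat.add_sub_cancel' hle]
  rw [rowInsert, dif_neg hne, hrowEnd, hlen]
  unfold tryPut at hend ⊢
  split_ifs at hend ⊢ with hput hempty
  · obtain ⟨rfl, rfl⟩ := hend.eq_of_put hT hfree
    rw [decide_eq_false hle.not_gt]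
  · have hpos := hend.insertPos_eq hT hfree
    have hka := hend.le
    have hcol : ∀ i, T.Has b i ↔ i < a + 1 := fun i =>
      has_comm.trans ((hend.has_col_iff i).trans Nat.lt_succ_iff.symm)
    have hbox : T.rowLast (k - 1) = cell a b := by
      rw [show k - 1 = b by omega, rowLast, hT.rowLen_eq hcol, cell_of_ge (by omega),
        show b + (a + 1 - b) - 1 = a by omega]
    rw [hbox, decide_eq_true (by omega)]
  · have hpos := hend.insertPos_eq hT hfree
    have hab : a ≤ b := not_lt.1 fun hba =>
      absurd ((hend.has_row_iff (b + 1)).1 (has_comm.1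
        (hT.has_mono hend.has hba (show k ≤ b by omega)))) (by omega)
    have hcol : ∀ i, T.Has b i ↔ i < a + 1 := fun i =>
      has_comm.trans ((hend.has_col_iff i).trans Nat.lt_succ_iff.symm)
    have hbox : T.colLast (T.rowLast k).2 = cell a b := by
      rw [rowLast, hlen, show k + (T.insertPos k x - k) - 1 = b by omega, colLast,
        hT.colLen_eq hcol, min_eq_left (by omega), Nat.add_sub_cancel, cell_of_le hab]
    rw [hbox, decide_eq_false hab.not_gt]

end OneRound

section Rounds

/-- The tableau and the letter in hand after the first `k` rounds of the insertion of `x` into `T`.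
Round `k` puts the letter into its place in row `k` of the doubled tableau, if this is admissible,
and takes the label that was there in hand. -/
noncomputable def bumpState (T : Filling) (x : ℕ) : ℕ → Filling × ℕ
  | 0 => (T, x)
  | k + 1 =>
    let s := bumpState T x k
    let p := s.1.insertPos k s.2
    (s.1.tryPut (cell k p) s.2, s.1.val k p)

/-- The tableau before round `k` of the insertion of `x` into `T`. -/
noncomputable def tableauAt (T : Filling) (x k : ℕ) : Filling := (T.bumpState x k).1

/-- The letter inserted in round `k` of the insertion of `x` into `T`. -/
noncomputable def letterAt (T : Filling) (x k : ℕ) : ℕ := (T.bumpState x k).2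

/-- The position in row `k` where round `k` of the insertion of `x` into `T` inserts. -/
noncomputable def posAt (T : Filling) (x k : ℕ) : ℕ :=
  (T.tableauAt x k).insertPos k (T.letterAt x k)

/-- Round `k` of the insertion of `x` into `T` leaves the tableau unchanged. -/
def BlockedAt (T : Filling) (x k : ℕ) : Prop :=
  ¬ ((T.tableauAt x k).put (cell k (T.posAt x k)) (T.letterAt x k)).IsIncreasing

/-- The insertion of `x` into `T` bumps a label in each of the first `k` rounds. The shape does not
change in these rounds, so that it can be taken from `T`. -/
def BumpsBefore (T : Filling) (x k : ℕ) : Prop := ∀ i < k, T.Has i (T.posAt x i)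

open Classical in
/-- The last position of row `k` whose label does not exceed the letter of round `k` after this
round: the position of the letter itself, or the one before if the round is blocked. -/
noncomputable def restPosAt (T : Filling) (x k : ℕ) : ℕ :=
  if T.BlockedAt x k then T.posAt x k - 1 else T.posAt x k

theorem tableauAt_succ_of_blockedAt (h : T.BlockedAt x k) :
    T.tableauAt x (k + 1) = T.tableauAt x k :=
  if_neg h

theorem tableauAt_succ_of_not_blockedAt (h : ¬ T.BlockedAt x k) :
    T.tableauAt x (k + 1) = (T.tableauAt x k).put (cell k (T.posAt x k)) (T.letterAt x k) :=
  if_pos (not_not.1 h)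

theorem IsIncreasing.tableauAt (hT : T.IsIncreasing) (x k : ℕ) :
    (T.tableauAt x k).IsIncreasing := by
  induction k with
  | zero => exact hT
  | succ k ih => exact ih.tryPut _ _

theorem entry_tableauAt_succ (T : Filling) (x k : ℕ) (c : ℕ × ℕ) :
    (T.tableauAt x (k + 1)).entry c = (T.tableauAt x k).entry c ∨
      c = cell k (T.posAt x k) ∧ (T.tableauAt x (k + 1)).entry c = T.letterAt x k ∧
        (T.tableauAt x k).entry c = T.letterAt x (k + 1) := by
  by_cases h : T.BlockedAt x k
  · rw [tableauAt_succ_of_blockedAt h]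
    exact Or.inl rfl
  · rw [tableauAt_succ_of_not_blockedAt h]
    by_cases hc : c = cell k (T.posAt x k)
    · subst hc
      exact Or.inr ⟨rfl, entry_put_self _ _ _, rfl⟩
    · exact Or.inl (entry_put_of_ne _ _ hc)

theorem entry_tableauAt_succ_of_ne {c : ℕ × ℕ} (h : c ≠ cell k (T.posAt x k)) :
    (T.tableauAt x (k + 1)).entry c = (T.tableauAt x k).entry c :=
  (entry_tableauAt_succ T x k c).resolve_right fun hc => h hc.1

theorem val_posAt_of_not_blockedAt (h : ¬ T.BlockedAt x k) :
    (T.tableauAt x (k + 1)).val k (T.posAt x k) = T.letterAt x k := by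
  rw [tableauAt_succ_of_not_blockedAt h, val, entry_put_self]

theorem val_le_letterAt_of_lt_posAt (hj : j < T.posAt x k) :
    (T.tableauAt x (k + 1)).val k j ≤ T.letterAt x k := by
  rw [val, entry_tableauAt_succ_of_ne fun h => hj.ne (cell_right_injective k h)]
  exact (has_and_val_le_of_lt_insertPos hj).2

theorem BumpsBefore.mono (h : T.BumpsBefore x k) (hi : i ≤ k) : T.BumpsBefore x i :=
  fun m hm => h m (hm.trans_le hi)

theorem BumpsBefore.succ (h : T.BumpsBefore x k) (hk : T.Has k (T.posAt x k)) :
    T.BumpsBefore x (k + 1) := by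
  intro i hi
  rcases Nat.lt_succ_iff_lt_or_eq.1 hi with hi | rfl
  · exact h i hi
  · exact hk

theorem BumpsBefore.cells_tableauAt (h : T.BumpsBefore x k) :
    (T.tableauAt x k).cells = T.cells := by
  induction k with
  | zero => rfl
  | succ k ih =>
    have hcells := ih (h.mono k.le_succ)
    refine (tryPut_cells _ _ _ ?_).trans hcells
    rw [← tableauAt, hcells]
    exact h k k.lt_succ_self

theorem BumpsBefore.has_tableauAt_iff (h : T.BumpsBefore x k) :
    (T.tableauAt x k).Has i j ↔ T.Has i j := by
  rw [Has, h.cells_tableauAt, Has]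

theorem BumpsBefore.letterAt_lt_succ (h : T.BumpsBefore x (k + 1)) :
    T.letterAt x k < T.letterAt x (k + 1) :=
  lt_val_insertPos ((h.mono k.le_succ).has_tableauAt_iff.2 (h k k.lt_succ_self))

theorem BumpsBefore.letterAt_mono (h : T.BumpsBefore x k) (hi : i ≤ k) :
    T.letterAt x i ≤ T.letterAt x k := by
  induction k, hi using Nat.le_induction with
  | base => exact le_rfl
  | succ k _ ih => exact (ih (h.mono k.le_succ)).trans h.letterAt_lt_succ.le

theorem BumpsBefore.entry_tableauAt (h : T.BumpsBefore x k) (hi : i ≤ k) (c : ℕ × ℕ) :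
    (T.tableauAt x k).entry c = (T.tableauAt x i).entry c ∨
      T.letterAt x i ≤ (T.tableauAt x k).entry c ∧
        T.letterAt x i < (T.tableauAt x i).entry c := by
  induction k, hi using Nat.le_induction with
  | base => exact Or.inl rfl
  | succ k hik ih =>
    have hk := h.mono k.le_succ
    have hmono := hk.letterAt_mono hik
    have hlt := h.letterAt_lt_succ
    have := ih hk
    have := entry_tableauAt_succ T x k c
    omega

theorem BumpsBefore.entry_tableauAt_eq_or_lt (h : T.BumpsBefore x k) (c : ℕ × ℕ) :
    (T.tableauAt x k).entry c = T.entry c ∨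
      (T.tableauAt x k).entry c < T.letterAt x k ∧ T.entry c ≤ T.letterAt x k := by
  induction k with
  | zero => exact Or.inl rfl
  | succ k ih =>
    have hlt := h.letterAt_lt_succ
    have := ih (h.mono k.le_succ)
    have := entry_tableauAt_succ T x k c
    omega

theorem BumpsBefore.letterAt_succ_eq (h : T.BumpsBefore x (k + 1)) :
    T.letterAt x (k + 1) = T.val k (T.posAt x k) :=
  ((h.mono k.le_succ).entry_tableauAt_eq_or_lt (cell k (T.posAt x k))).resolve_right fun hlt =>
    hlt.1.not_gt h.letterAt_lt_succ

theorem BumpsBefore.bump_of_lt (h : T.BumpsBefore x k) (hT : T.IsIncreasing) (hq : T.Has k j)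
    (hlt : T.letterAt x k < T.val k j) :
    T.BumpsBefore x (k + 1) ∧ T.letterAt x (k + 1) ≤ T.val k j := by
  have hval : (T.tableauAt x k).val k j = T.val k j :=
    (h.entry_tableauAt_eq_or_lt (cell k j)).resolve_right fun hle => hle.2.not_gt hlt
  have hpos : T.posAt x k ≤ j := insertPos_le fun _ => hval ▸ hlt
  refine ⟨h.succ (hT.has_mono hq le_rfl hpos), ?_⟩
  rw [← hval]
  exact (hT.tableauAt x k).val_le_right (h.has_tableauAt_iff.2 hq) hpos

theorem BumpsBefore.letterAt_succ_le_of_lt (h : T.BumpsBefore x (k + 1)) (hT : T.IsIncreasing)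
    (hj : T.Has k j) (hlt : T.letterAt x k < (T.tableauAt x (k + 1)).val k j) :
    T.letterAt x (k + 1) ≤ (T.tableauAt x (k + 1)).val k j := by
  have hpos : T.posAt x k ≤ j := by
    by_contra! hjp
    exact (val_le_letterAt_of_lt_posAt hjp).not_gt hlt
  rcases entry_tableauAt_succ T x k (cell k j) with hsame | ⟨-, hnew, -⟩
  · rw [val, hsame]
    exact (hT.tableauAt x k).val_le_right ((h.mono k.le_succ).has_tableauAt_iff.2 hj) hpos
  · exact absurd hnew hlt.ne'

theorem BumpsBefore.posAt_succ_le (h : T.BumpsBefore x (k + 1)) (hT : T.IsIncreasing) :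
    T.posAt x (k + 1) ≤ T.posAt x k := by
  refine insertPos_le fun hhas => ?_
  rw [val, entry_tableauAt_succ_of_ne (cell_succ_left_ne _ _)]
  exact (hT.tableauAt x k).val_lt_down
    ((h.mono k.le_succ).has_tableauAt_iff.2 (h.has_tableauAt_iff.1 hhas)) k.lt_succ_self

theorem BumpsBefore.val_le_letterAt_succ (h : T.BumpsBefore x (k + 1)) (hj : j ≤ T.posAt x k) :
    (T.tableauAt x (k + 1)).val k j ≤ T.letterAt x (k + 1) := by
  rcases hj.lt_or_eq with hj | rfl
  · exact (val_le_letterAt_of_lt_posAt hj).trans h.letterAt_lt_succ.le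
  · rcases entry_tableauAt_succ T x k (cell k (T.posAt x k)) with hsame | ⟨-, hnew, -⟩
    · exact hsame.le
    · exact hnew.trans_le h.letterAt_lt_succ.le

theorem BumpsBefore.lt_posAt_succ (h : T.BumpsBefore x (k + 1)) (hT : T.IsIncreasing)
    (hk : k < T.posAt x k) : k < T.posAt x (k + 1) := by
  by_contra! hle
  have hhas : (T.tableauAt x (k + 1)).Has (k + 1) k :=
    has_comm.1 (h.has_tableauAt_iff.2 (hT.has_mono (h k k.lt_succ_self) le_rfl hk))
  have hI := hT.tableauAt x (k + 1)
  refine lt_irrefl (T.letterAt x (k + 1)) ?_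
  calc T.letterAt x (k + 1)
      < (T.tableauAt x (k + 1)).val (k + 1) (T.posAt x (k + 1)) :=
        lt_val_insertPos (hI.has_mono hhas le_rfl hle)
    _ ≤ (T.tableauAt x (k + 1)).val (k + 1) k := hI.val_le_right hhas hle
    _ = (T.tableauAt x (k + 1)).val k (k + 1) := val_comm _ _ _
    _ ≤ T.letterAt x (k + 1) := h.val_le_letterAt_succ hk

theorem BlockedAt.eq_left_or_blockedAt_above (hb : T.BlockedAt x k) (hT : T.IsIncreasing)
    (h : T.BumpsBefore x k) :
    (∃ q, T.posAt x k = q + 1 ∧ (T.tableauAt x k).val k q = T.letterAt x k) ∨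
      ∃ m, k = m + 1 ∧ T.posAt x m = T.posAt x k ∧ T.BlockedAt x m := by
  rcases (hT.tableauAt x k).obstruction_of_not_put hb with hleft | ⟨m, rfl, habove⟩
  · exact Or.inl hleft
  have hle := h.posAt_succ_le hT
  have hge : T.letterAt x (m + 1) ≤ (T.tableauAt x (m + 1)).val m (T.posAt x (m + 1)) :=
    habove (h.has_tableauAt_iff.2 (hT.has_mono (h m m.lt_succ_self) le_rfl hle))
  have hletter := h.letterAt_lt_succ
  have hpos : T.posAt x m = T.posAt x (m + 1) := by
    refine (hle.eq_or_lt.resolve_right fun hlt => ?_).symm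
    exact ((val_le_letterAt_of_lt_posAt hlt).trans_lt hletter).not_ge hge
  refine Or.inr ⟨m, rfl, hpos, fun hput => ?_⟩
  rw [← hpos, val_posAt_of_not_blockedAt (not_not.2 hput)] at hge
  exact hletter.not_ge hge

theorem BlockedAt.posAt_pos (hb : T.BlockedAt x k) (hT : T.IsIncreasing) (h : T.BumpsBefore x k) :
    0 < T.posAt x k := by
  induction k with
  | zero =>
    rcases hb.eq_left_or_blockedAt_above hT h with ⟨q, hq, -⟩ | ⟨m, hm, -⟩ <;> omega
  | succ k ih =>
    rcases hb.eq_left_or_blockedAt_above hT h with ⟨q, hq, -⟩ | ⟨m, hm, hpos, hb'⟩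
    · omega
    · obtain rfl : k = m := by omega
      exact hpos ▸ ih hb' (h.mono k.le_succ)

theorem BumpsBefore.has_and_val_restPosAt_le (h : T.BumpsBefore x k) (hT : T.IsIncreasing) :
    (T.tableauAt x (k + 1)).Has k (T.restPosAt x k) ∧
      (T.tableauAt x (k + 1)).val k (T.restPosAt x k) ≤ T.letterAt x k := by
  unfold restPosAt
  split_ifs with hb
  · have hpos := hb.posAt_pos hT h
    rw [tableauAt_succ_of_blockedAt hb]
    exact has_and_val_le_of_lt_insertPos (Nat.sub_lt hpos one_pos)
  · refine ⟨?_, (val_posAt_of_not_blockedAt hb).le⟩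
    rw [tableauAt_succ_of_not_blockedAt hb]
    exact has_put.2 (Or.inl rfl)

theorem BumpsBefore.val_restPosAt_eq_or (h : T.BumpsBefore x k) (hT : T.IsIncreasing) :
    (T.tableauAt x (k + 1)).val k (T.restPosAt x k) = T.letterAt x k ∨
      ∃ m, k = m + 1 ∧ T.restPosAt x m = T.restPosAt x k := by
  by_cases hb : T.BlockedAt x k
  · rcases hb.eq_left_or_blockedAt_above hT h with ⟨q, hq, heq⟩ | ⟨m, hm, hpos, hb'⟩
    · left
      rwa [restPosAt, if_pos hb, tableauAt_succ_of_blockedAt hb, hq, Nat.add_sub_cancel]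
    · exact Or.inr ⟨m, hm, by rw [restPosAt, restPosAt, if_pos hb, if_pos hb', hpos]⟩
  · left
    rw [restPosAt, if_neg hb, val_posAt_of_not_blockedAt hb]

end Rounds

section Insertion

/-- The insertion of `x` into `T` stops in round `e`, where it bumps no label, and it terminates at
the box `(a, b)` of the doubled shape. The resulting tableau is `T.tableauAt x (e + 1)`. -/
structure EndsAt (T : Filling) (x e a b : ℕ) : Prop where
  bumpsBefore : T.BumpsBefore x e
  not_has_posAt : ¬ T.Has e (T.posAt x e)
  isEndBox : (T.tableauAt x (e + 1)).IsEndBox e a b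

variable {e a b : ℕ}

theorem IsIncreasing.exists_endsAt (hT : T.IsIncreasing) (x : ℕ) :
    ∃ e a b, T.EndsAt x e a b := by
  classical
  have hex : ∃ e, ¬ T.Has e (T.posAt x e) := by
    by_contra! hall
    obtain ⟨i, hi⟩ := T.exists_not_has 0
    exact hi (has_comm.1 (hT.has_mono (hall i) le_rfl (Nat.zero_le _)))
  have hbumps : T.BumpsBefore x (Nat.find hex) := fun i hi => not_not.1 (Nat.find_min hex hi)
  obtain ⟨a, b, hab⟩ :=
    (hT.tableauAt x (Nat.find hex + 1)).exists_isEndBox (hbumps.has_and_val_restPosAt_le hT).1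
  exact ⟨Nat.find hex, a, b, hbumps, Nat.find_spec hex, hab⟩

theorem EndsAt.not_has_tableauAt (h : T.EndsAt x e a b) :
    ¬ (T.tableauAt x e).Has e (T.posAt x e) :=
  h.bumpsBefore.has_tableauAt_iff.not.2 h.not_has_posAt

theorem EndsAt.colInsert_tableauAt (h : T.EndsAt x e a b) (hT : T.IsIncreasing) (hk : k ≤ e)
    (hlt : T.posAt x k < k) :
    colInsert (T.tableauAt x k) k (T.letterAt x k) =
      ⟨T.tableauAt x (e + 1), cell a b, decide (b < a)⟩ := by
  induction hk using Nat.decreasingInduction with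
  | self => exact colInsert_of_free (hT.tableauAt x e) hlt h.not_has_tableauAt h.isEndBox
  | of_succ k hk ih =>
    have hbumps : T.BumpsBefore x (k + 1) := h.bumpsBefore.mono hk
    exact (colInsert_of_has (hT.tableauAt x k) hlt.le ((hbumps.mono k.le_succ).has_tableauAt_iff.2
      (hbumps k k.lt_succ_self))).trans (ih ((hbumps.posAt_succ_le hT).trans_lt (by omega)))

theorem EndsAt.rowInsert_tableauAt (h : T.EndsAt x e a b) (hT : T.IsIncreasing) (hk : k ≤ e)
    (hle : k ≤ T.posAt x k) :
    rowInsert (T.tableauAt x k) k (T.letterAt x k) =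
      ⟨T.tableauAt x (e + 1), cell a b, decide (b < a)⟩ := by
  induction hk using Nat.decreasingInduction with
  | self => exact rowInsert_of_free (hT.tableauAt x e) hle h.not_has_tableauAt h.isEndBox
  | of_succ k hk ih =>
    have hbumps : T.BumpsBefore x (k + 1) := h.bumpsBefore.mono hk
    refine (rowInsert_of_has (hT.tableauAt x k) hle ((hbumps.mono k.le_succ).has_tableauAt_iff.2
      (hbumps k k.lt_succ_self))).trans ?_
    rw [← posAt]
    split_ifs with heq
    · exact h.colInsert_tableauAt hT hk ((hbumps.posAt_succ_le hT).trans_lt (by omega))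
    · exact ih (hbumps.lt_posAt_succ hT (by omega))

theorem EndsAt.insertLetter_eq (h : T.EndsAt x e a b) (hT : T.IsIncreasing) :
    insertLetter T x = ⟨T.tableauAt x (e + 1), cell a b, decide (b < a)⟩ :=
  h.rowInsert_tableauAt hT (Nat.zero_le e) (Nat.zero_le _)

theorem EndsAt.eq_of_not_blockedAt (h : T.EndsAt x e a b) (hT : T.IsIncreasing)
    (hb : ¬ T.BlockedAt x e) : a = e ∧ b = T.posAt x e := by
  have hend := h.isEndBox
  rw [tableauAt_succ_of_not_blockedAt hb] at hend
  exact hend.eq_of_put (hT.tableauAt x e) h.not_has_tableauAt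

theorem EndsAt.restPosAt_eq (h : T.EndsAt x e a b) (hT : T.IsIncreasing) :
    T.restPosAt x e = b := by
  unfold restPosAt
  split_ifs with hb
  · have hend := h.isEndBox
    rw [tableauAt_succ_of_blockedAt hb] at hend
    have : T.posAt x e = b + 1 := hend.insertPos_eq (hT.tableauAt x e) h.not_has_tableauAt
    omega
  · exact (h.eq_of_not_blockedAt hT hb).2.symm

theorem EndsAt.has_of_has (h : T.EndsAt x e a b) (hij : T.Has i j) :
    (T.tableauAt x (e + 1)).Has i j := by
  rw [← h.bumpsBefore.has_tableauAt_iff] at hij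
  by_cases hb : T.BlockedAt x e
  · rwa [tableauAt_succ_of_blockedAt hb]
  · rw [tableauAt_succ_of_not_blockedAt hb]
    exact has_put.2 (Or.inr hij)

theorem EndsAt.has_or_cell_eq_of_has (h : T.EndsAt x e a b)
    (hij : (T.tableauAt x (e + 1)).Has i j) :
    T.Has i j ∨ cell i j = cell e (T.posAt x e) ∧ ¬ T.BlockedAt x e := by
  by_cases hb : T.BlockedAt x e
  · rw [tableauAt_succ_of_blockedAt hb] at hij
    exact Or.inl (h.bumpsBefore.has_tableauAt_iff.1 hij)
  · rw [tableauAt_succ_of_not_blockedAt hb, has_put, h.bumpsBefore.has_tableauAt_iff] at hij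
    exact hij.symm.imp_right fun hc => ⟨hc, hb⟩

theorem EndsAt.val_tableauAt_succ (h : T.EndsAt x e a b) (hij : T.Has i j) :
    (T.tableauAt x (e + 1)).val i j = (T.tableauAt x e).val i j :=
  entry_tableauAt_succ_of_ne fun hc => h.not_has_posAt (by rwa [Has, ← hc])

theorem EndsAt.val_restPosAt (h : T.EndsAt x e a b) (hT : T.IsIncreasing) (hk : k ≤ e) :
    (T.tableauAt x (e + 1)).val k (T.restPosAt x k) =
      (T.tableauAt x (k + 1)).val k (T.restPosAt x k) := by
  rcases hk.eq_or_lt with rfl | hlt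
  · rfl
  have hbumps : T.BumpsBefore x (k + 1) := h.bumpsBefore.mono hlt
  obtain ⟨hhas, hle⟩ := (hbumps.mono k.le_succ).has_and_val_restPosAt_le hT
  rw [h.val_tableauAt_succ (hbumps.has_tableauAt_iff.1 hhas)]
  exact (h.bumpsBefore.entry_tableauAt hlt _).resolve_right fun hgt =>
    (hle.trans hbumps.letterAt_lt_succ.le).not_gt hgt.2

theorem EndsAt.has_restPosAt (h : T.EndsAt x e a b) (hT : T.IsIncreasing) (hk : k ≤ e) :
    (T.tableauAt x (e + 1)).Has k (T.restPosAt x k) := by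
  have hhas := ((h.bumpsBefore.mono hk).has_and_val_restPosAt_le hT).1
  rcases hk.eq_or_lt with rfl | hlt
  · exact hhas
  · exact h.has_of_has ((h.bumpsBefore.mono hlt).has_tableauAt_iff.1 hhas)

theorem EndsAt.val_restPosAt_le (h : T.EndsAt x e a b) (hT : T.IsIncreasing) (hk : k ≤ e) :
    (T.tableauAt x (e + 1)).val k (T.restPosAt x k) ≤ T.letterAt x k := by
  rw [h.val_restPosAt hT hk]
  exact ((h.bumpsBefore.mono hk).has_and_val_restPosAt_le hT).2

theorem EndsAt.val_restPosAt_eq_or (h : T.EndsAt x e a b) (hT : T.IsIncreasing) (hk : k ≤ e) :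
    (T.tableauAt x (e + 1)).val k (T.restPosAt x k) = T.letterAt x k ∨
      ∃ m, k = m + 1 ∧ T.restPosAt x m = T.restPosAt x k := by
  rw [h.val_restPosAt hT hk]
  exact (h.bumpsBefore.mono hk).val_restPosAt_eq_or hT

end Insertion

section ConsecutiveInsertions

variable {e a b x' e' a' b' : ℕ}

theorem EndsAt.lt_and_letterAt_succ_le_of_lt (h : T.EndsAt x e a b) (hT : T.IsIncreasing)
    (hk : k ≤ e) (hj : (T.tableauAt x (e + 1)).Has k j)
    (hlt : T.letterAt x k < (T.tableauAt x (e + 1)).val k j) :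
    k < e ∧ T.letterAt x (k + 1) ≤ (T.tableauAt x (e + 1)).val k j := by
  have hke : k < e := by
    refine hk.lt_of_ne fun heq => ?_
    subst heq
    have hjb : j ≤ T.restPosAt x k := by
      rw [h.restPosAt_eq hT]
      exact (h.isEndBox.has_row_iff j).1 hj
    exact (((hT.tableauAt x (k + 1)).val_le_right (h.has_restPosAt hT le_rfl) hjb).trans
      (h.val_restPosAt_le hT le_rfl)).not_gt hlt
  refine ⟨hke, ?_⟩
  rcases h.has_or_cell_eq_of_has hj with hold | ⟨hnew, hb⟩
  · rw [h.val_tableauAt_succ hold] at hlt ⊢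
    rcases h.bumpsBefore.entry_tableauAt hke (cell k j) with hsame | hge
    · rw [val, hsame] at hlt ⊢
      exact (h.bumpsBefore.mono hke).letterAt_succ_le_of_lt hT hold hlt
    · exact hge.1
  · rw [val, hnew, ← val, val_posAt_of_not_blockedAt hb]
    exact h.bumpsBefore.letterAt_mono hke

theorem EndsAt.le_and_letterAt_le_of_le (h : T.EndsAt x e a b) (hT : T.IsIncreasing)
    (hx : x ≤ x') (hk : (T.tableauAt x (e + 1)).BumpsBefore x' k) :
    k ≤ e ∧ T.letterAt x k ≤ (T.tableauAt x (e + 1)).letterAt x' k := by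
  induction k with
  | zero => exact ⟨Nat.zero_le e, hx⟩
  | succ k ih =>
    obtain ⟨hke, hle⟩ := ih (hk.mono k.le_succ)
    have hlt := hle.trans_lt hk.letterAt_lt_succ
    rw [hk.letterAt_succ_eq] at hlt ⊢
    exact h.lt_and_letterAt_succ_le_of_lt hT hke (hk k k.lt_succ_self) hlt

theorem EndsAt.not_lt_and_lt (h : T.EndsAt x e a b) (hT : T.IsIncreasing)
    (h' : (T.tableauAt x (e + 1)).EndsAt x' e' a' b') : ¬ (a < a' ∧ b < b') := by
  rintro ⟨ha, hb⟩
  have hF := hT.tableauAt x (e + 1)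
  rcases h'.has_or_cell_eq_of_has ((hF.tableauAt x' (e' + 1)).has_mono h'.isEndBox.has ha hb.le)
    with hold | ⟨hnew, hnb⟩
  · exact a.lt_irrefl ((h.isEndBox.has_col_iff _).1 hold)
  · obtain ⟨rfl, rfl⟩ := h'.eq_of_not_blockedAt hF hnb
    have := cell_eq_cell_iff.1 hnew
    omega

theorem EndsAt.row_le_and_col_lt_or_eq_of_le (h : T.EndsAt x e a b) (hT : T.IsIncreasing)
    (h' : (T.tableauAt x (e + 1)).EndsAt x' e' a' b') (hx : x ≤ x') :
    a' ≤ a ∧ (b < b' ∨ a' = a ∧ b' = b) := by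
  have hF := hT.tableauAt x (e + 1)
  have hea : e' ≤ a := (h.le_and_letterAt_le_of_le hT hx h'.bumpsBefore).1.trans h.isEndBox.le
  have hab := h'.has_of_has h.isEndBox.has
  have hbb : b ≤ b' :=
    (h'.isEndBox.has_row_iff b).1 ((hF.tableauAt x' (e' + 1)).has_mono hab hea le_rfl)
  rcases hbb.lt_or_eq with hlt | rfl
  · have := h.not_lt_and_lt hT h'
    omega
  · have hle : a ≤ a' := (h'.isEndBox.has_col_iff a).1 hab
    have hge : a' ≤ a := by
      rcases h'.has_or_cell_eq_of_has h'.isEndBox.has with hold | ⟨-, hnb⟩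
      · exact (h.isEndBox.has_col_iff a').1 hold
      · exact (h'.eq_of_not_blockedAt hF hnb).1.trans_le hea
    exact ⟨hge, Or.inr ⟨hge.antisymm hle, rfl⟩⟩

theorem EndsAt.bumpsBefore_and_letterAt_lt_of_lt (h : T.EndsAt x e a b) (hT : T.IsIncreasing)
    (hx : x' < x) (hk : k ≤ e) :
    (T.tableauAt x (e + 1)).BumpsBefore x' k ∧
      (T.tableauAt x (e + 1)).letterAt x' k <
        (T.tableauAt x (e + 1)).val k (T.restPosAt x k) := by
  have hF := hT.tableauAt x (e + 1)
  induction k with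
  | zero =>
    refine ⟨fun i hi => absurd hi i.not_lt_zero, ?_⟩
    rcases h.val_restPosAt_eq_or hT hk with heq | ⟨m, hm, -⟩
    · rwa [heq]
    · omega
  | succ k ih =>
    obtain ⟨hbumps, hlt⟩ := ih (k.le_succ.trans hk)
    obtain ⟨hbumps', hle⟩ := hbumps.bump_of_lt hF (h.has_restPosAt hT (k.le_succ.trans hk)) hlt
    refine ⟨hbumps', hle.trans_lt ?_⟩
    rcases h.val_restPosAt_eq_or hT hk with heq | ⟨m, hm, hrest⟩
    · rw [heq]
      exact (h.val_restPosAt_le hT (k.le_succ.trans hk)).trans_lt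
        (h.bumpsBefore.mono hk).letterAt_lt_succ
    · obtain rfl : k = m := by omega
      rw [hrest]
      exact hF.val_lt_down (h.has_restPosAt hT hk) k.lt_succ_self

theorem EndsAt.bumpsBefore_succ_of_lt (h : T.EndsAt x e a b) (hT : T.IsIncreasing)
    (hx : x' < x) (hek : e ≤ k) (hka : k ≤ a) :
    (T.tableauAt x (e + 1)).BumpsBefore x' (k + 1) ∧
      (T.tableauAt x (e + 1)).letterAt x' (k + 1) ≤ (T.tableauAt x (e + 1)).val k b := by
  have hF := hT.tableauAt x (e + 1)
  induction k, hek using Nat.le_induction with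
  | base =>
    obtain ⟨hbumps, hlt⟩ := h.bumpsBefore_and_letterAt_lt_of_lt hT hx le_rfl
    rw [h.restPosAt_eq hT] at hlt
    exact hbumps.bump_of_lt hF ((h.isEndBox.has_col_iff e).2 hka) hlt
  | succ k _ ih =>
    obtain ⟨hbumps, hle⟩ := ih (k.le_succ.trans hka)
    have hhas := (h.isEndBox.has_col_iff (k + 1)).2 hka
    exact hbumps.bump_of_lt hF hhas (hle.trans_lt (hF.val_lt_down hhas k.lt_succ_self))

theorem EndsAt.row_lt_and_col_le_of_lt (h : T.EndsAt x e a b) (hT : T.IsIncreasing)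
    (h' : (T.tableauAt x (e + 1)).EndsAt x' e' a' b') (hx : x' < x) : a < a' ∧ b' ≤ b := by
  have hae : a < e' := by
    by_contra! hle
    exact h'.not_has_posAt
      ((h.bumpsBefore_succ_of_lt hT hx h.isEndBox.le le_rfl).1 e' (Nat.lt_succ_of_le hle))
  have haa : a < a' := hae.trans_le h'.isEndBox.le
  exact ⟨haa, not_lt.1 fun hlt => h.not_lt_and_lt hT h' ⟨haa, hlt⟩⟩

end ConsecutiveInsertions

end Filling

theorem isIncreasing_insertLetter {T : Filling} (hT : T.IsIncreasing) (x : ℕ) :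
    (insertLetter T x).tableau.IsIncreasing := by
  obtain ⟨e, a, b, h⟩ := hT.exists_endsAt x
  rw [h.insertLetter_eq hT]
  exact hT.tableauAt x (e + 1)

/-- The descent condition on the recording labels of two consecutive insertions with the results
`r` and `r'`. -/
def InsertResult.IsDescent (r r' : InsertResult) : Prop :=
  (r.primed = false ∧ r'.primed = true) ∨
    (r.primed = false ∧ r'.primed = false ∧ r.box.1 < r'.box.1) ∨
      (r.primed = true ∧ r'.primed = true ∧ r'.box.1 ≤ r.box.1 ∧ r.box ≠ r'.box)

theorem isDescent_insertLetter_iff {T : Filling} (hT : T.IsIncreasing) (x x' : ℕ) :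
    (insertLetter T x).IsDescent (insertLetter (insertLetter T x).tableau x') ↔ x' < x := by
  obtain ⟨e, a, b, h⟩ := hT.exists_endsAt x
  have hF := hT.tableauAt x (e + 1)
  obtain ⟨e', a', b', h'⟩ := hF.exists_endsAt x'
  simp only [h.insertLetter_eq hT, h'.insertLetter_eq hF, InsertResult.IsDescent, cell, ne_eq,
    Prod.mk.injEq, decide_eq_true_eq, decide_eq_false_iff_not]
  rcases lt_or_ge x' x with hx | hx
  · have := h.row_lt_and_col_le_of_lt hT h' hx
    refine iff_of_true ?_ hx
    omega
  · have := h.row_le_and_col_lt_or_eq_of_le hT h' hx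
    refine iff_of_false ?_ hx.not_gt
    omega

theorem run_append_singleton (w : List ℕ) (x : ℕ) : run (w ++ [x]) = (run w).step x := by
  rw [run, run, List.foldl_append, List.foldl_cons, List.foldl_nil]

theorem run_len (w : List ℕ) : (run w).len = w.length := by
  induction w using List.reverseRecOn with
  | nil => rfl
  | append_singleton w x ih =>
    rw [run_append_singleton, List.length_append, List.length_singleton, ← ih]
    rfl

theorem insertionTableau_append_singleton (w : List ℕ) (x : ℕ) :
    insertionTableau (w ++ [x]) = (insertLetter (insertionTableau w) x).tableau := by
  rw [insertionTableau, run_append_singleton]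
  rfl

theorem isIncreasing_insertionTableau (w : List ℕ) : (insertionTableau w).IsIncreasing := by
  induction w using List.reverseRecOn with
  | nil => exact Filling.isIncreasing_empty
  | append_singleton w x ih =>
    rw [insertionTableau_append_singleton]
    exact isIncreasing_insertLetter ih x

theorem mem_recordingTableau_append_singleton {w : List ℕ} {x i : ℕ} {p : Bool} {s : ℕ × ℕ} :
    ⟨i, p⟩ ∈ recordingTableau (w ++ [x]) s ↔ ⟨i, p⟩ ∈ recordingTableau w s ∨
      i = w.length + 1 ∧ (insertLetter (insertionTableau w) x).box = s ∧
        (insertLetter (insertionTableau w) x).primed = p := by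
  have hstep : recordingTableau (w ++ [x]) = Function.update (recordingTableau w)
      (insertLetter (insertionTableau w) x).box
      (insert ⟨w.length + 1, (insertLetter (insertionTableau w) x).primed⟩
        (recordingTableau w (insertLetter (insertionTableau w) x).box)) := by
    rw [recordingTableau, run_append_singleton, ← run_len]
    rfl
  rw [hstep]
  by_cases hs : s = (insertLetter (insertionTableau w) x).box
  · subst hs
    rw [Function.update_self, Finset.mem_insert, Label.mk.injEq, or_comm]
    simp only [true_and, eq_comm]
  · rw [Function.update_of_ne hs]
    simp only [Ne.symm hs, false_and, and_false, or_false]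

theorem mem_Icc_of_mem_recordingTableau {w : List ℕ} {i : ℕ} {p : Bool} {s : ℕ × ℕ}
    (h : ⟨i, p⟩ ∈ recordingTableau w s) : i ∈ Set.Icc 1 w.length := by
  induction w using List.reverseRecOn with
  | nil => exact absurd h (Finset.notMem_empty _)
  | append_singleton w x ih =>
    rw [Set.mem_Icc, List.length_append, List.length_singleton]
    rcases mem_recordingTableau_append_singleton.1 h with hw | ⟨rfl, -⟩
    · exact ⟨(ih hw).1, Nat.le_succ_of_le (ih hw).2⟩
    · omega

theorem mem_recordingTableau_append_cons {u v : List ℕ} {x : ℕ} {p : Bool} {s : ℕ × ℕ} :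
    ⟨u.length + 1, p⟩ ∈ recordingTableau (u ++ x :: v) s ↔
      (insertLetter (insertionTableau u) x).box = s ∧
        (insertLetter (insertionTableau u) x).primed = p := by
  induction v using List.reverseRecOn with
  | nil =>
    rw [mem_recordingTableau_append_singleton, or_iff_right, and_iff_right rfl]
    exact fun h => absurd (mem_Icc_of_mem_recordingTableau h).2 (Nat.not_succ_le_self _)
  | append_singleton v y ih =>
    rw [← List.cons_append, ← List.append_assoc, mem_recordingTableau_append_singleton, ih,
      or_iff_left]
    rintro ⟨hlen, -⟩
    rw [List.length_append, List.length_cons] at hlen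
    omega

theorem mem_wordDescents_append_cons_cons {u v : List ℕ} {x x' : ℕ} :
    u.length + 1 ∈ wordDescents (u ++ x :: x' :: v) ↔ x' < x := by
  simp [wordDescents]

theorem mem_tableauDescents_append_cons_cons {u v : List ℕ} {x x' : ℕ} :
    u.length + 1 ∈ tableauDescents (recordingTableau (u ++ x :: x' :: v)) ↔
      (insertLetter (insertionTableau u) x).IsDescent
        (insertLetter (insertLetter (insertionTableau u) x).tableau x') := by
  have hsnd : ∀ {p s}, ⟨u.length + 1 + 1, p⟩ ∈ recordingTableau (u ++ x :: x' :: v) s ↔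
      (insertLetter (insertLetter (insertionTableau u) x).tableau x').box = s ∧
        (insertLetter (insertLetter (insertionTableau u) x).tableau x').primed = p := by
    intro p s
    have := mem_recordingTableau_append_cons (u := u ++ [x]) (v := v) (x := x') (p := p) (s := s)
    rwa [List.append_assoc, List.singleton_append, List.length_append, List.length_singleton,
      insertionTableau_append_singleton] at this
  simp only [tableauDescents, Set.mem_ofPred_eq, mem_recordingTableau_append_cons, hsnd,
    InsertResult.IsDescent]
  aesop

theorem mem_Ico_of_mem_wordDescents {w : List ℕ} {i : ℕ} (h : i ∈ wordDescents w) :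
    i ∈ Set.Ico 1 w.length := by
  obtain ⟨hi, a, b, -, hb, -⟩ := h
  exact ⟨hi, (List.getElem?_eq_some_iff.1 hb).1⟩

theorem mem_Ico_of_mem_tableauDescents {w : List ℕ} {i : ℕ}
    (h : i ∈ tableauDescents (recordingTableau w)) : i ∈ Set.Ico 1 w.length := by
  rcases h with ⟨s, t, hs, ht⟩ | ⟨s, t, hs, ht, -⟩ | ⟨s, t, hs, ht, -⟩ <;>
    exact ⟨(mem_Icc_of_mem_recordingTableau hs).1, (mem_Icc_of_mem_recordingTableau ht).2⟩

theorem exists_eq_append_cons_cons {α : Type*} {w : List α} {i : ℕ}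
    (hi : i ∈ Set.Ico 1 w.length) :
    ∃ u x x' v, w = u ++ x :: x' :: v ∧ i = u.length + 1 := by
  obtain ⟨hi, hlt⟩ := hi
  refine ⟨w.take (i - 1), w[i - 1], w[i], w.drop (i + 1), ?_, ?_⟩
  · have hdrop := List.drop_eq_getElem_cons (l := w) (i := i - 1) (by omega)
    rw [Nat.sub_add_cancel hi] at hdrop
    rw [← List.drop_eq_getElem_cons hlt, ← hdrop, List.take_append_drop]
  · rw [List.length_take]
    omega

end ShiftedHecke

theorem mainTheorem7 (w : List ℕ) (hw : ∀ a ∈ w, 0 < a) :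
    ShiftedHecke.wordDescents w =
      ShiftedHecke.tableauDescents (ShiftedHecke.recordingTableau w) := by
  ext i
  by_cases hi : i ∈ Set.Ico 1 w.length
  · obtain ⟨u, x, x', v, rfl, rfl⟩ := ShiftedHecke.exists_eq_append_cons_cons hi
    rw [ShiftedHecke.mem_wordDescents_append_cons_cons,
      ShiftedHecke.mem_tableauDescents_append_cons_cons,
      ShiftedHecke.isDescent_insertLetter_iff (ShiftedHecke.isIncreasing_insertionTableau u)]
  · exact iff_of_false (fun h => hi (ShiftedHecke.mem_Ico_of_mem_wordDescents h))
      (fun h => hi (ShiftedHecke.mem_Ico_of_mem_tableauDescents h))
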